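/- Let $k\ge 1$ be an integer and put $\phi_k=\frac{\pi}{2(2k+1)}$. Let $X_{2k+1}$ be the pseudo-process started at $0$ with transition density $$u_{2k+1}(x,s)=\frac1{2\pi}\int_{-\infty}^{\infty}e^{-i\beta x+i(-1)^k s\beta^{2k+1}}\,d\beta=\lim_{R\to\infty}\frac1{2\pi}\int_{-R}^{R}e^{-i\beta x+i(-1)^k s\beta^{2k+1}}\,d\beta ,\qquad x\in\mathbb R,\ s>0,$$ the fundamental solution of $\partial_s u=-\partial_x^{2k+1}u$; that is, for $0=t_0<t_1<\dots<t_n$ and $x_0=0$ the cylinder $\{a_j\le X_{2k+1}(t_j)\le b_j,\ j=1,\dots,n\}$ has signed measure $\int_{a_1}^{b_1}\!\cdots\int_{a_n}^{b_n}\prod_{j=1}^n u_{2k+1}(x_j-x_{j-1},t_j-t_{j-1})\,dx_n\cdots dx_1$. Let $S(t)$, $t>0$, be a positively skewed stable process of index $\alpha=\frac1{2k+1}$, i.e. $$\mathbb E\,e^{i\beta S(t)}=\exp\!\big(-t|\beta|^{\alpha}e^{-i\frac{\pi\alpha}{2}\operatorname{sgn}\beta}\big),\qquad \beta\in\mathbb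 R,\ t>0,$$ independent of $X_{2k+1}$. The law of the composition $X_{2k+1}(S(t))$ is $$\Pr\{a\le X_{2k+1}(S(t))\le b\}=\int_0^\infty \mu\{a\le X_{2k+1}(s)\le b\}\,\Pr\{S(t)\in ds\},\qquad a\le b,$$ where $\mu$ denotes the signed measure of cylinders above, and its density is $\int_0^\infty u_{2k+1}(x,s)\Pr\{S(t)\in ds\}$. Then the limit defining $u_{2k+1}(x,s)$ exists and is real, the integrals over $s$ converge absolutely, and for every $t>0$ the composition $X_{2k+1}(S(t))$ has a Cauchy probability distribution with location $(-1)^k t\sin\phi_k$ and scale $t\cos\phi_k$: for all $x\in\mathbb R$ and $t>0$, $$\Pr\{X_{2k+1}(S(t))\in dx\}/dx=\int_0^\infty u_{2k+1}(x,s)\Pr\{S(t)\in ds\}=\frac{t\cos\phi_k}{\pi\big[(x+(-1)^{k+1}t\sin\phi_k)^2+t^2\cos^2\phi_k\big]} .$$ This density is smooth on $\mathbb R\times(0,\infty)$ and solves $$\frac{\partial^{2k+1}u}{\partial t^{2k+1}}+\frac{\partial^{2k+1}u}{\partial x^{2k+1}}=0,\qquad x\in\mathbb R,\ t>0 .$$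 -/

import Mathlib

open Filter Topology MeasureTheory ProbabilityTheory
open scoped ContDiff

/-- The truncated inverse Fourier integral
`(1/2π) ∫_{-R}^{R} e^{-iβx} e^{i(-1)^k s β^{2k+1}} dβ`. -/
noncomputable def truncKernel (k : ℕ) (x s R : ℝ) : ℂ :=
  (1 / (2 * (Real.pi : ℂ))) * ∫ β in (-R)..R,
    Complex.exp (-Complex.I * (β : ℂ) * (x : ℂ)) *
      Complex.exp (Complex.I * (-1 : ℂ) ^ k * (s : ℂ) * (β : ℂ) ^ (2 * k + 1))

/-- The transition density `u_{2k+1}(x, s)` of the pseudo-process `X_{2k+1}`, i.e. the fundamental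
solution of `∂u/∂s = -∂^{2k+1}u/∂x^{2k+1}`: the improper integral
`(1/2π) ∫_{-∞}^{∞} e^{-iβx + i(-1)^k s β^{2k+1}} dβ`, the limit of the truncated integrals.
(The integral does not converge absolutely; that the limit exists and is real is part of the
theorem.) -/
noncomputable def pseudoDensity (k : ℕ) (x s : ℝ) : ℝ :=
  (limUnder atTop (truncKernel k x s)).re

/-- The signed measure that the pseudo-process `X_{2k+1}` (started at `0` at time `0`) gives to the
cylinder `{ω : a_j ≤ ω(t_j) ≤ b_j, j = 1, …, n}`, for times `0 < t_1 < ⋯ < t_n`: the integral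
over the box of the product of `u_{2k+1}(x_j - x_{j-1}, t_j - t_{j-1})`, with `x_0 = t_0 = 0`.
Here `Fin.cons 0 x` lists `x_0, x_1, …, x_n`. -/
noncomputable def pseudoCylinder (k n : ℕ) (t a b : Fin n → ℝ) : ℝ :=
  ∫ x in Set.Icc a b, ∏ j : Fin n,
    pseudoDensity k (x j - (Fin.cons 0 x : Fin (n + 1) → ℝ) j.castSucc)
      (t j - (Fin.cons 0 t : Fin (n + 1) → ℝ) j.castSucc)

/-- `μ{a ≤ X_{2k+1}(s) ≤ b}`: the one-time cylinder. -/
noncomputable def pseudoLaw (k : ℕ) (s a b : ℝ) : ℝ :=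
  pseudoCylinder k 1 (fun _ => s) (fun _ => a) (fun _ => b)

/-- The characteristic function `exp(-t |β|^α e^{-i(πγ/2) sgn β})` of a stable law. The value
`γ = α`, with `0 < α < 1`, is the positively skewed case. -/
noncomputable def stableCharFun (α γ t β : ℝ) : ℂ :=
  Complex.exp (-((t * |β| ^ α : ℝ) : ℂ) *
    Complex.exp (-Complex.I * ((Real.pi * γ / 2 * Real.sign β : ℝ) : ℂ)))

/-- `S(t)`, `t > 0`, are real random variables with
`E e^{iβS(t)} = exp(-t |β|^α e^{-i(πγ/2) sgn β})`. Every stable process with parameters `α`, `γ`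
has this property; nothing is asked of the joint law at several times. -/
structure HasStableLaws {Ω : Type*} [MeasurableSpace Ω] (P : Measure Ω) (α γ : ℝ)
    (S : ℝ → Ω → ℝ) : Prop where
  aemeasurable : ∀ t, 0 < t → AEMeasurable (S t) P
  charFun_eq : ∀ t, 0 < t → ∀ β : ℝ, charFun (P.map (S t)) β = stableCharFun α γ t β

/-- The density `∫_0^∞ u_{2k+1}(x, s) Pr{S(t) ∈ ds}` at `x` of the composition `X_{2k+1}(S(t))` of
the pseudo-process with an independent positive process `S`. -/
noncomputable def composedDensity {Ω : Type*} [MeasurableSpace Ω] (P : Measure Ω) (k : ℕ)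
    (S : ℝ → Ω → ℝ) (x t : ℝ) : ℝ :=
  ∫ s in Set.Ioi 0, pseudoDensity k x s ∂(P.map (S t))

/-- `Pr{a ≤ X_{2k+1}(S(t)) ≤ b} = ∫_0^∞ μ{a ≤ X_{2k+1}(s) ≤ b} Pr{S(t) ∈ ds}`, the law of the
composition of the pseudo-process with an independent positive process `S`. -/
noncomputable def composedLaw {Ω : Type*} [MeasurableSpace Ω] (P : Measure Ω) (k : ℕ)
    (S : ℝ → Ω → ℝ) (t a b : ℝ) : ℝ :=
  ∫ s in Set.Ioi 0, pseudoLaw k s a b ∂(P.map (S t))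

/-- The angle `π / (2(2k+1))`. -/
noncomputable def cauchyAngle (k : ℕ) : ℝ := Real.pi / (2 * (2 * (k : ℝ) + 1))

/-- The asymmetric Cauchy density. -/
noncomputable def asymCauchyDensity (k : ℕ) (x t : ℝ) : ℝ :=
  t * Real.cos (cauchyAngle k) /
    (Real.pi * ((x + (-1) ^ (k + 1) * t * Real.sin (cauchyAngle k)) ^ 2
      + t ^ 2 * Real.cos (cauchyAngle k) ^ 2))

/-! Formally, the Fourier transform of `u_{2k+1}(·, s)` is `e^{i(-1)^k s β^{2k+1}}`. Averaging over
`s = S(t)` evaluates the characteristic function of `S(t)` at `(-1)^k β^{2k+1}`. Since `α =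
1/(2k+1)`, this is `exp(-t|β| cos φ_k + i(-1)^k t β sin φ_k)`, the characteristic function of the
stated Cauchy law (`stableCharFun_neg_one_pow_mul_pow`).

The work is to justify the exchange of integrals, because the β-integral converges only
conditionally. For truncated kernels Fubini is harmless (`integral_truncKernel`), and the truncation
is removed by dominated convergence (`integral_pseudoDensity_eq`). The majorant `10 s^{-α}` comes
from an estimate for `∫ cos(v^{2k+1} + yv) dv` that is uniform in `y` and in the cutoff, followed by
scaling (`norm_truncKernel_le`).

Two facts about `S(t)` remain, and both are extracted from its characteristic function alone. That
function is integrable, so balls of radius `r` about 0 have mass `O(r)`, whence `|S(t)|^{-α}` is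
integrable and 0 is not an atom. It also continues to the upper half plane as `exp(-t(-iz)^α)`;
pairing it with a Gamma characteristic function and shifting the contour shows that the negative
half-line carries no mass.

For the differential equation, the density is `π⁻¹ Re 1/(tω + ix)` with `|ω| = 1` and `ω^{2k+1} =
-i^{2k+1}`: derivatives in `t` and `x` produce powers of `ω` and of `i`, and these cancel at order
`2k+1`. -/

/-! ### Oscillatory integrals with phase `v^{2k+1} + yv` -/

/-- First derivative test for oscillatory integrals. -/
theorem abs_integral_cos_le_of_le_abs_deriv {φ φ' φ'' : ℝ → ℝ} {a b l : ℝ} (hab : a ≤ b)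
    (hl : 0 < l) (h1 : ∀ v ∈ Set.Icc a b, HasDerivAt φ (φ' v) v)
    (h2 : ∀ v ∈ Set.Icc a b, HasDerivAt φ' (φ'' v) v) (hc : ContinuousOn φ'' (Set.Icc a b))
    (hpos : ∀ v ∈ Set.Icc a b, 0 ≤ φ'' v) (hlow : ∀ v ∈ Set.Icc a b, l ≤ |φ' v|) :
    |∫ v in a..b, Real.cos (φ v)| ≤ 4 / l := by
  have hne : ∀ v ∈ Set.Icc a b, φ' v ≠ 0 := fun v hv h => by
    have := hlow v hv
    rw [h, abs_zero] at this
    linarith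
  have c1 : ContinuousOn φ (Set.Icc a b) := fun v hv => (h1 v hv).continuousAt.continuousWithinAt
  have c2 : ContinuousOn φ' (Set.Icc a b) := fun v hv => (h2 v hv).continuousAt.continuousWithinAt
  have cq : ContinuousOn (fun v => φ'' v / φ' v ^ 2) (Set.Icc a b) :=
    hc.div (c2.pow 2) fun v hv => pow_ne_zero 2 (hne v hv)
  have cs : ContinuousOn (fun v => Real.sin (φ v) * (φ'' v / φ' v ^ 2)) (Set.Icc a b) :=
    (Real.continuous_sin.comp_continuousOn c1).mul cq
  have cc : ContinuousOn (fun v => Real.cos (φ v)) (Set.Icc a b) :=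
    Real.continuous_cos.comp_continuousOn c1
  have icc := Set.uIcc_of_le hab
  have iq : IntervalIntegrable (fun v => φ'' v / φ' v ^ 2) volume a b :=
    ContinuousOn.intervalIntegrable (by rwa [icc])
  have is : IntervalIntegrable (fun v => Real.sin (φ v) * (φ'' v / φ' v ^ 2)) volume a b :=
    ContinuousOn.intervalIntegrable (by rwa [icc])
  have ic : IntervalIntegrable (fun v => Real.cos (φ v)) volume a b :=
    ContinuousOn.intervalIntegrable (by rwa [icc])
  -- Integration by parts: the derivative of `sin φ / φ'` is `cos φ - sin φ · φ''/φ'²`. As `φ'' ≥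
  -- 0`, the remainder is dominated by `∫ φ''/φ'²`, which telescopes. Four boundary terms of size at
  -- most `1/l` result.
  have e1 : ∫ v in a..b, (Real.cos (φ v) - Real.sin (φ v) * (φ'' v / φ' v ^ 2)) =
      Real.sin (φ b) / φ' b - Real.sin (φ a) / φ' a := by
    refine intervalIntegral.integral_eq_sub_of_hasDerivAt
      (f := fun v => Real.sin (φ v) / φ' v) (fun v hv => ?_) (ic.sub is)
    rw [icc] at hv
    have := hne v hv
    refine ((h1 v hv).sin.div (h2 v hv) this).congr_deriv ?_
    field_simp
  have e2 : ∫ v in a..b, φ'' v / φ' v ^ 2 = - (φ' b)⁻¹ - - (φ' a)⁻¹ := by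
    refine intervalIntegral.integral_eq_sub_of_hasDerivAt
      (f := fun v => - (φ' v)⁻¹) (fun v hv => ?_) iq
    rw [icc] at hv
    refine ((h2 v hv).inv (hne v hv)).neg.congr_deriv ?_
    ring
  rw [intervalIntegral.integral_sub ic is] at e1
  have e3 : |∫ v in a..b, Real.sin (φ v) * (φ'' v / φ' v ^ 2)| ≤ ∫ v in a..b, φ'' v / φ' v ^ 2 := by
    refine intervalIntegral.norm_integral_le_of_norm_le
      (f := fun v => Real.sin (φ v) * (φ'' v / φ' v ^ 2)) hab (ae_of_all _ fun v hv => ?_) iq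
    have hv' : v ∈ Set.Icc a b := ⟨hv.1.le, hv.2⟩
    have h0 : 0 ≤ φ'' v / φ' v ^ 2 := div_nonneg (hpos v hv') (sq_nonneg _)
    rw [norm_mul, Real.norm_of_nonneg h0]
    exact mul_le_of_le_one_left h0 (Real.abs_sin_le_one _)
  have hinv : ∀ v ∈ Set.Icc a b, |(φ' v)⁻¹| ≤ 1 / l := fun v hv => by
    rw [abs_inv, one_div]
    exact inv_anti₀ hl (hlow v hv)
  have hsin : ∀ v ∈ Set.Icc a b, |Real.sin (φ v) / φ' v| ≤ 1 / l := fun v hv => by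
    rw [div_eq_mul_inv, abs_mul]
    exact (mul_le_of_le_one_left (abs_nonneg _) (Real.abs_sin_le_one _)).trans (hinv v hv)
  have ha := Set.left_mem_Icc.2 hab
  have hb := Set.right_mem_Icc.2 hab
  have a1 := abs_le.1 (hinv a ha)
  have a2 := abs_le.1 (hinv b hb)
  have a3 := abs_le.1 (hsin a ha)
  have a4 := abs_le.1 (hsin b hb)
  have a5 := abs_le.1 (e3.trans_eq e2)
  have : 4 / l = 4 * (1 / l) := by ring
  rw [this, abs_le]
  constructor <;> linarith [a1.1, a1.2, a2.1, a2.2, a3.1, a3.2, a4.1, a4.2, a5.1, a5.2]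

theorem abs_integral_cos_pow_add_mul_le (k : ℕ) {y a b l : ℝ} (ha : 0 ≤ a) (hab : a ≤ b)
    (hl : 0 < l) (hlow : ∀ v ∈ Set.Icc a b, l ≤ |(2 * k + 1) * v ^ (2 * k) + y|) :
    |∫ v in a..b, Real.cos (v ^ (2 * k + 1) + y * v)| ≤ 4 / l := by
  refine abs_integral_cos_le_of_le_abs_deriv (φ' := fun v => (2 * k + 1) * v ^ (2 * k) + y)
    (φ'' := fun v => (2 * k + 1) * (2 * k * v ^ (2 * k - 1))) hab hl (fun v _ => ?_) (fun v _ => ?_)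
    (by fun_prop) (fun v hv => ?_) hlow
  · refine ((hasDerivAt_pow (2 * k + 1) v).add ((hasDerivAt_id v).const_mul y)).congr_deriv ?_
    push_cast
    simp
  · refine (((hasDerivAt_pow (2 * k) v).const_mul (2 * (k : ℝ) + 1)).add_const y).congr_deriv ?_
    push_cast
    ring
  · have := ha.trans hv.1
    positivity

theorem continuous_cos_pow_add_mul (n : ℕ) (y : ℝ) :
    Continuous fun v : ℝ => Real.cos (v ^ n + y * v) := by fun_prop

/-- The integrals `∫_0^R cos(v^{2k+1} + yv) dv` are bounded uniformly in `y` and `R`. -/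
theorem abs_integral_cos_pow_add_mul_le_ten {k : ℕ} (hk : 1 ≤ k) (y : ℝ) {R : ℝ} (hR : 0 ≤ R) :
    |∫ v in 0..R, Real.cos (v ^ (2 * k + 1) + y * v)| ≤ 10 := by
  have hk1 : (1 : ℝ) ≤ 2 * k + 1 := by
    have : (0 : ℝ) ≤ k := k.cast_nonneg
    linarith
  have h2k : 2 * k ≠ 0 := by omega
  -- `c` is the stationary point of the phase when that exceeds 1, and 1 otherwise. The window of
  -- radius 1 about `c` contributes at most its length 2, and each side at most 4, since the phase
  -- has slope at least 1 in modulus there. When `c = 1` the left side is empty.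
  obtain ⟨c, hc1, hc, hc'⟩ : ∃ c : ℝ, 1 ≤ c ∧ 0 ≤ (2 * k + 1) * c ^ (2 * k) + y ∧
      (c = 1 ∨ (2 * k + 1) * c ^ (2 * k) + y = 0) := by
    by_cases h : 0 ≤ (2 * k + 1) + y
    · exact ⟨1, le_rfl, by simpa using h, Or.inl rfl⟩
    · push Not at h
      have h0 : (2 * (k : ℝ) + 1) * ((-y / (2 * k + 1)) ^ (((2 * k : ℕ) : ℝ)⁻¹)) ^ (2 * k) + y = 0 := by
        rw [Real.rpow_inv_natCast_pow (div_nonneg (by linarith) (by linarith)) h2k]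
        field_simp
        ring
      refine ⟨(-y / (2 * k + 1)) ^ (((2 * k : ℕ) : ℝ)⁻¹), ?_, h0.ge, Or.inr h0⟩
      refine Real.one_le_rpow ?_ (by positivity)
      rw [le_div_iff₀ (by linarith)]
      linarith
  have hstep : ∀ v : ℝ, 0 ≤ v → v ^ (2 * k) + 1 ≤ (v + 1) ^ (2 * k) := fun v hv => by
    simpa using pow_add_pow_le hv zero_le_one h2k
  have hi : ∀ a b : ℝ, IntervalIntegrable (fun v : ℝ => Real.cos (v ^ (2 * k + 1) + y * v))
      volume a b := fun a b => (continuous_cos_pow_add_mul _ y).intervalIntegrable a b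
  have p1 : 0 ≤ min R (c - 1) := le_min hR (by linarith)
  have p2 : min R (c - 1) ≤ min R (c + 1) := min_le_min_left _ (by linarith)
  have p3 : min R (c + 1) ≤ R := min_le_left _ _
  have b1 : |∫ v in 0..min R (c - 1), Real.cos (v ^ (2 * k + 1) + y * v)| ≤ 4 / 1 := by
    rcases hc' with h | h
    · have : min R (c - 1) = 0 := by rw [h]; simpa using hR
      rw [this]
      simp
    · refine abs_integral_cos_pow_add_mul_le k le_rfl p1 one_pos fun v hv => ?_
      have h1 := hstep v hv.1
      have h2 : (v + 1) ^ (2 * k) ≤ c ^ (2 * k) := by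
        have := hv.2.trans (min_le_right _ _)
        exact pow_le_pow_left₀ (by linarith [hv.1]) (by linarith) _
      rw [le_abs]
      right
      nlinarith
  have b2 : |∫ v in (min R (c - 1))..(min R (c + 1)), Real.cos (v ^ (2 * k + 1) + y * v)| ≤ 2 := by
    have := intervalIntegral.norm_integral_le_of_norm_le_const (a := min R (c - 1))
      (b := min R (c + 1)) (f := fun v : ℝ => Real.cos (v ^ (2 * k + 1) + y * v)) (C := 1)
      fun v _ => Real.abs_cos_le_one _
    rw [abs_of_nonneg (by linarith), one_mul] at this
    refine this.trans ?_
    rcases le_total R (c - 1) with h | h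
    · rw [min_eq_left h, min_eq_left (by linarith)]
      norm_num
    · rw [min_eq_right h]
      linarith [min_le_right R (c + 1)]
  have b3 : |∫ v in (min R (c + 1))..R, Real.cos (v ^ (2 * k + 1) + y * v)| ≤ 4 / 1 := by
    rcases le_total R (c + 1) with h | h
    · rw [min_eq_left h]
      simp
    · rw [min_eq_right h]
      refine abs_integral_cos_pow_add_mul_le k (by linarith) h one_pos fun v hv => ?_
      have h1 := hstep c (by linarith)
      have h2 : (c + 1) ^ (2 * k) ≤ v ^ (2 * k) := pow_le_pow_left₀ (by linarith) hv.1 _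
      rw [le_abs]
      left
      nlinarith
  rw [← intervalIntegral.integral_add_adjacent_intervals (hi 0 (min R (c + 1))) (hi _ R),
    ← intervalIntegral.integral_add_adjacent_intervals (hi 0 (min R (c - 1))) (hi _ _)]
  refine (abs_add_le _ _).trans ((add_le_add_left (abs_add_le _ _) _).trans ?_)
  linarith

theorem exists_tendsto_integral_cos_pow_add_mul {k : ℕ} (hk : 1 ≤ k) (y : ℝ) :
    ∃ L, Tendsto (fun R : ℝ => ∫ v in 0..R, Real.cos (v ^ (2 * k + 1) + y * v)) atTop (𝓝 L) := by
  refine cauchySeq_tendsto_of_complete (Metric.cauchySeq_iff'.2 fun ε hε => ?_)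
  -- Beyond this threshold the slope of the phase is at least `v + y ≥ 5/ε`, so every tail is at
  -- most `4ε/5`.
  refine ⟨max 1 (5 / ε - y), fun R hR => ?_⟩
  have hi : ∀ a b : ℝ, IntervalIntegrable (fun v : ℝ => Real.cos (v ^ (2 * k + 1) + y * v))
      volume a b := fun a b => (continuous_cos_pow_add_mul _ y).intervalIntegrable a b
  rw [Real.dist_eq, intervalIntegral.integral_interval_sub_left (hi _ _) (hi _ _)]
  have h0 : (0 : ℝ) ≤ max 1 (5 / ε - y) := zero_le_one.trans (le_max_left _ _)
  refine (abs_integral_cos_pow_add_mul_le k h0 hR (l := 5 / ε) (by positivity)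
    fun v hv => ?_).trans_lt ?_
  · have h1 : 1 ≤ v := (le_max_left _ _).trans hv.1
    have h2 : 5 / ε - y ≤ v := (le_max_right _ _).trans hv.1
    have h3 : v ≤ v ^ (2 * k) := le_self_pow₀ h1 (by omega)
    have : (0 : ℝ) ≤ k := k.cast_nonneg
    have h4 : v ^ (2 * k) ≤ (2 * k + 1) * v ^ (2 * k) :=
      le_mul_of_one_le_left (by linarith) (by linarith)
    rw [le_abs]
    left
    linarith
  · field_simp
    norm_num

/-! ### Scaling, and the truncated kernel -/

/-- The substitution that normalises the leading coefficient changes only `y` and the cutoff. Bounds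
uniform in both therefore depend on `s` only through the prefactor. -/
theorem integral_cos_mul_pow_add_mul (k : ℕ) {s : ℝ} (hs : 0 < s) (y R : ℝ) :
    ∫ v in 0..R, Real.cos (s * v ^ (2 * k + 1) + y * v) =
      s ^ (-(1 / (2 * (k : ℝ) + 1))) * ∫ v in 0..(s ^ (1 / (2 * (k : ℝ) + 1)) * R),
        Real.cos (v ^ (2 * k + 1) + y * s ^ (-(1 / (2 * (k : ℝ) + 1))) * v) := by
  have hr := Real.rpow_pos_of_pos hs (1 / (2 * (k : ℝ) + 1))
  have hp : (s ^ (1 / (2 * (k : ℝ) + 1))) ^ (2 * k + 1) = s := by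
    have := Real.rpow_inv_natCast_pow hs.le (n := 2 * k + 1) (by omega)
    push_cast at this
    rwa [one_div]
  rw [Real.rpow_neg hs.le]
  set r := s ^ (1 / (2 * (k : ℝ) + 1)) with hrdef
  have := intervalIntegral.integral_comp_mul_left (a := 0) (b := R)
    (fun v => Real.cos (v ^ (2 * k + 1) + y * r⁻¹ * v)) hr.ne'
  rw [mul_zero, smul_eq_mul] at this
  rw [← this]
  congr 1
  ext v
  rw [mul_pow, hp]
  congr 2
  field_simp

/-- The phase is odd in `β`, so the contributions of `β` and `-β` are conjugate and add up to twice
a cosine. The sign `(-1)^k`, pulled out of the phase, is absorbed by the evenness of the cosine. -/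
theorem truncKernel_eq_ofReal (k : ℕ) (x s R : ℝ) :
    truncKernel k x s R = ((1 / Real.pi * ∫ β in 0..R,
      Real.cos (s * β ^ (2 * k + 1) + -((-1) ^ k * x) * β) : ℝ) : ℂ) := by
  have hf : ∀ β : ℝ, Complex.exp (-Complex.I * (β : ℂ) * (x : ℂ)) *
      Complex.exp (Complex.I * (-1 : ℂ) ^ k * (s : ℂ) * (β : ℂ) ^ (2 * k + 1)) =
      Complex.exp (((-1) ^ k * (s * β ^ (2 * k + 1) + -((-1) ^ k * x) * β) : ℝ) * Complex.I) := by
    intro β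
    rw [← Complex.exp_add]
    congr 1
    have : ((-1 : ℂ) ^ k) * (-1) ^ k = 1 := by rw [← mul_pow]; norm_num
    push_cast
    linear_combination (x : ℂ) * β * Complex.I * this
  have hcos : ∀ θ : ℝ, Real.cos ((-1) ^ k * θ) = Real.cos θ := fun θ => by
    rcases neg_one_pow_eq_or ℝ k with h | h <;> simp [h]
  have hneg : ∀ β : ℝ, s * (-β) ^ (2 * k + 1) + -((-1) ^ k * x) * -β =
      -(s * β ^ (2 * k + 1) + -((-1) ^ k * x) * β) := fun β => by
    rw [Odd.neg_pow ⟨k, rfl⟩]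
    ring
  rw [truncKernel]
  simp_rw [hf]
  have hc : Continuous fun β : ℝ => Complex.exp
      (((-1) ^ k * (s * β ^ (2 * k + 1) + -((-1) ^ k * x) * β) : ℝ) * Complex.I) := by fun_prop
  have hc' : Continuous fun β : ℝ => Complex.exp
      (((-1) ^ k * (s * (-β) ^ (2 * k + 1) + -((-1) ^ k * x) * -β) : ℝ) * Complex.I) := by fun_prop
  rw [← intervalIntegral.integral_add_adjacent_intervals (hc.intervalIntegrable (-R) 0)
    (hc.intervalIntegrable 0 R)]
  have hrefl := intervalIntegral.integral_comp_neg (a := 0) (b := R) fun β : ℝ => Complex.exp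
      (((-1) ^ k * (s * β ^ (2 * k + 1) + -((-1) ^ k * x) * β) : ℝ) * Complex.I)
  rw [neg_zero] at hrefl
  rw [← hrefl, ← intervalIntegral.integral_add (hc'.intervalIntegrable 0 R)
    (hc.intervalIntegrable 0 R)]
  have hsum : ∀ β : ℝ, Complex.exp
      (((-1) ^ k * (s * (-β) ^ (2 * k + 1) + -((-1) ^ k * x) * -β) : ℝ) * Complex.I) +
      Complex.exp (((-1) ^ k * (s * β ^ (2 * k + 1) + -((-1) ^ k * x) * β) : ℝ) * Complex.I) =
      ((2 * Real.cos (s * β ^ (2 * k + 1) + -((-1) ^ k * x) * β) : ℝ) : ℂ) := by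
    intro β
    rw [hneg, ← hcos, Complex.ofReal_mul 2, Complex.ofReal_cos, Complex.ofReal_ofNat,
      Complex.two_cos, add_comm]
    congr 2
    push_cast
    ring
  simp_rw [hsum]
  rw [intervalIntegral.integral_ofReal, intervalIntegral.integral_const_mul]
  have := Real.pi_ne_zero
  push_cast
  field_simp

theorem norm_truncKernel_le {k : ℕ} (hk : 1 ≤ k) (x : ℝ) {s R : ℝ} (hs : 0 < s) (hR : 0 ≤ R) :
    ‖truncKernel k x s R‖ ≤ 10 * s ^ (-(1 / (2 * (k : ℝ) + 1))) := by
  have hr := Real.rpow_pos_of_pos hs (1 / (2 * (k : ℝ) + 1))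
  have hr' := Real.rpow_pos_of_pos hs (-(1 / (2 * (k : ℝ) + 1)))
  rw [truncKernel_eq_ofReal, Complex.norm_real, integral_cos_mul_pow_add_mul k hs, norm_mul,
    norm_mul, Real.norm_of_nonneg hr'.le, Real.norm_of_nonneg (by positivity), Real.norm_eq_abs]
  have h1 : 1 / Real.pi ≤ 1 := by
    rw [div_le_one Real.pi_pos]
    linarith [Real.pi_gt_three]
  have h2 := abs_integral_cos_pow_add_mul_le_ten hk
    (-((-1) ^ k * x) * s ^ (-(1 / (2 * (k : ℝ) + 1)))) (mul_nonneg hr.le hR)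
  calc _ ≤ 1 * (s ^ (-(1 / (2 * (k : ℝ) + 1))) * 10) := by gcongr
    _ = _ := by ring

theorem tendsto_truncKernel {k : ℕ} (hk : 1 ≤ k) (x : ℝ) {s : ℝ} (hs : 0 < s) :
    Tendsto (truncKernel k x s) atTop (𝓝 ((pseudoDensity k x s : ℝ) : ℂ)) := by
  have hr := Real.rpow_pos_of_pos hs (1 / (2 * (k : ℝ) + 1))
  obtain ⟨L, hL⟩ := exists_tendsto_integral_cos_pow_add_mul hk
    (-((-1) ^ k * x) * s ^ (-(1 / (2 * (k : ℝ) + 1))))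
  have h : Tendsto (truncKernel k x s) atTop
      (𝓝 ((1 / Real.pi * (s ^ (-(1 / (2 * (k : ℝ) + 1))) * L) : ℝ) : ℂ)) := by
    simp_rw [funext (truncKernel_eq_ofReal k x s), integral_cos_mul_pow_add_mul k hs]
    exact (Complex.continuous_ofReal.tendsto _).comp
      (((hL.comp (tendsto_id.const_mul_atTop hr)).const_mul _).const_mul _)
  rwa [pseudoDensity, h.limUnder_eq, Complex.ofReal_re]

theorem abs_pseudoDensity_le {k : ℕ} (hk : 1 ≤ k) (x : ℝ) {s : ℝ} (hs : 0 < s) :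
    |pseudoDensity k x s| ≤ 10 * s ^ (-(1 / (2 * (k : ℝ) + 1))) := by
  have := (tendsto_truncKernel hk x hs).norm
  rw [Complex.norm_real] at this
  exact le_of_tendsto this ((eventually_ge_atTop 0).mono fun R hR => norm_truncKernel_le hk x hs hR)

/-! ### Fubini and Fourier transforms -/

theorem integrable_mul_exp_mul_I {α : Type*} [MeasurableSpace α] {ν : Measure α} [SFinite ν]
    (μ : Measure ℝ) [IsFiniteMeasure μ] {h : α → ℂ} (hh : Integrable h ν) {θ : α → ℝ}
    (hθ : Measurable θ) :
    Integrable (fun p : ℝ × α => h p.2 * Complex.exp (θ p.2 * p.1 * Complex.I)) (μ.prod ν) := by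
  have h1 : Integrable (fun p : ℝ × α => h p.2) (μ.prod ν) := hh.comp_snd μ
  refine h1.mul_bdd (c := 1) (by fun_prop) (ae_of_all _ fun p => ?_)
  rw [← Complex.ofReal_mul, Complex.norm_exp_ofReal_mul_I]

/-- Fubini's theorem for a superposition of exponentials. -/
theorem integral_integral_mul_exp_eq_integral_mul_charFun {α : Type*} [MeasurableSpace α]
    {ν : Measure α} [SFinite ν] (μ : Measure ℝ) [IsFiniteMeasure μ] {h : α → ℂ}
    (hh : Integrable h ν) {θ : α → ℝ} (hθ : Measurable θ) :
    ∫ s, ∫ β, h β * Complex.exp (θ β * s * Complex.I) ∂ν ∂μ = ∫ β, h β * charFun μ (θ β) ∂ν := by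
  rw [integral_integral_swap (integrable_mul_exp_mul_I μ hh hθ)]
  simp_rw [integral_const_mul, charFun_apply_real]

theorem integrable_of_integrableOn_Ioi_comp_abs {E : Type*} [NormedAddCommGroup E] {f : ℝ → E}
    {g : ℝ → ℝ} (hf : AEStronglyMeasurable f) (hg : IntegrableOn g (Set.Ioi 0))
    (hfg : ∀ x, ‖f x‖ = g |x|) : Integrable f := by
  have h1 : IntegrableOn f (Set.Ioi 0) := by
    refine hg.mono' hf.restrict ?_
    filter_upwards [ae_restrict_mem measurableSet_Ioi] with x hx
    rw [hfg, abs_of_pos hx]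
  have h2 : IntegrableOn f (Set.Iio 0) := by
    have hg' : IntegrableOn (fun x => g (-x)) (Set.Iio 0) := by
      rw [← neg_zero] at hg
      exact hg.comp_neg_Iio
    refine hg'.mono' hf.restrict ?_
    filter_upwards [ae_restrict_mem measurableSet_Iio] with x hx
    rw [hfg, abs_of_neg hx]
  rw [← integrableOn_univ, ← Set.Iic_union_Ioi (a := (0 : ℝ))]
  exact (integrableOn_Iic_iff_integrableOn_Iio (by simp) |>.2 h2).union h1

theorem integrable_exp_neg_mul_abs {c : ℝ} (hc : 0 < c) :
    Integrable fun β : ℝ => Real.exp (-(c * |β|)) := by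
  refine integrable_of_integrableOn_Ioi_comp_abs (by fun_prop)
    (g := fun x => Real.exp (-c * x)) (integrableOn_exp_mul_Ioi (by linarith) 0) fun x => ?_
  rw [Real.norm_of_nonneg (Real.exp_pos _).le, neg_mul]

theorem integrable_exp_neg_mul_abs_rpow {c α : ℝ} (hc : 0 < c) (hα : 0 < α) :
    Integrable fun β : ℝ => Real.exp (-(c * |β| ^ α)) := by
  have := integrableOn_rpow_mul_exp_neg_mul_rpow (s := 0) (by norm_num) hα hc
  simp only [Real.rpow_zero, one_mul] at this
  refine integrable_of_integrableOn_Ioi_comp_abs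
    (Measurable.aestronglyMeasurable (by fun_prop)) this fun x => ?_
  rw [Real.norm_of_nonneg (Real.exp_pos _).le, neg_mul]

/-- The Fourier transform of the Laplace density. -/
theorem integral_exp_neg_mul_abs_mul_exp {c : ℝ} (hc : 0 < c) (y : ℝ) :
    ∫ β : ℝ, (Real.exp (-(c * |β|)) : ℂ) * Complex.exp (β * y * Complex.I) =
      ((2 * c / (c ^ 2 + y ^ 2) : ℝ) : ℂ) := by
  have hi : Integrable fun β : ℝ => (Real.exp (-(c * |β|)) : ℂ) * Complex.exp (β * y * Complex.I) := by
    refine (integrable_exp_neg_mul_abs hc).ofReal.mul_bdd (c := 1) (by fun_prop) (ae_of_all _ fun p => ?_)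
    rw [← Complex.ofReal_mul, Complex.norm_exp_ofReal_mul_I]
  rw [← intervalIntegral.integral_Iic_add_Ioi (b := 0) hi.integrableOn hi.integrableOn]
  have e1 : ∫ β in Set.Iic (0 : ℝ), (Real.exp (-(c * |β|)) : ℂ) * Complex.exp (β * y * Complex.I) =
      ∫ β in Set.Iic (0 : ℝ), Complex.exp ((c + y * Complex.I) * β) := by
    refine setIntegral_congr_fun measurableSet_Iic fun β hβ => ?_
    simp only [Set.mem_Iic] at hβ
    rw [abs_of_nonpos hβ, Complex.ofReal_exp, ← Complex.exp_add]
    congr 1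
    push_cast
    ring
  have e2 : ∫ β in Set.Ioi (0 : ℝ), (Real.exp (-(c * |β|)) : ℂ) * Complex.exp (β * y * Complex.I) =
      ∫ β in Set.Ioi (0 : ℝ), Complex.exp ((-c + y * Complex.I) * β) := by
    refine setIntegral_congr_fun measurableSet_Ioi fun β hβ => ?_
    simp only [Set.mem_Ioi] at hβ
    rw [abs_of_pos hβ, Complex.ofReal_exp, ← Complex.exp_add]
    congr 1
    push_cast
    ring
  have n1 : (c + y * Complex.I : ℂ) ≠ 0 := fun h => hc.ne' (by simpa using congrArg Complex.re h)
  have n2 : (-c + y * Complex.I : ℂ) ≠ 0 := fun h => hc.ne' (by simpa using congrArg Complex.re h)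
  have n3 : (c ^ 2 + y ^ 2 : ℂ) ≠ 0 := by
    have : c ^ 2 + y ^ 2 ≠ 0 := by positivity
    exact_mod_cast this
  rw [e1, e2, integral_exp_mul_complex_Iic (by simpa using hc),
    integral_exp_mul_complex_Ioi (by simpa using hc)]
  simp only [Complex.ofReal_zero, mul_zero, Complex.exp_zero]
  push_cast
  rw [div_add_div _ _ n1 n2, div_eq_div_iff (mul_ne_zero n1 n2) n3]
  linear_combination -(2 * c * (y : ℂ) ^ 2) * Complex.I_sq

/-! ### Small balls and negative moments -/

theorem norm_charFun_le_exp {μ : Measure ℝ} {α t β : ℝ}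
    (hμ : charFun μ β = stableCharFun α α t β) (hα : 0 < α) :
    ‖charFun μ β‖ ≤ Real.exp (-(t * Real.cos (Real.pi * α / 2) * |β| ^ α)) := by
  rw [hμ, stableCharFun, Complex.norm_exp, Real.exp_le_exp]
  have : (-Complex.I * ((Real.pi * α / 2 * Real.sign β : ℝ) : ℂ)) =
    ((-(Real.pi * α / 2 * Real.sign β) : ℝ) : ℂ) * Complex.I := by push_cast; ring
  rw [this, ← Complex.ofReal_neg, Complex.re_ofReal_mul, Complex.exp_ofReal_mul_I_re, Real.cos_neg]
  rcases lt_trichotomy β 0 with h | h | h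
  · rw [Real.sign_of_neg h, mul_neg_one, Real.cos_neg]
    exact le_of_eq (by ring)
  · simp [h, Real.zero_rpow hα.ne']
  · rw [Real.sign_of_pos h, mul_one]
    exact le_of_eq (by ring)

/-- If the characteristic function is integrable, small balls have measure `O(r)`. -/
theorem measureReal_abs_le_le_of_integrable_charFun (μ : Measure ℝ) [IsProbabilityMeasure μ]
    (hint : Integrable (charFun μ)) {r : ℝ} (hr : 0 < r) :
    μ.real {s | |s| ≤ r} ≤ (∫ β, ‖charFun μ β‖) * r := by
  have h1 : ∫ s, ((2 * r / (r ^ 2 + s ^ 2) : ℝ) : ℂ) ∂μ =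
      ∫ β : ℝ, (Real.exp (-(r * |β|)) : ℂ) * charFun μ β := by
    refine Eq.trans ?_ (integral_integral_mul_exp_eq_integral_mul_charFun μ
      (integrable_exp_neg_mul_abs hr).ofReal measurable_id)
    exact integral_congr_ae (ae_of_all _ fun s => (integral_exp_neg_mul_abs_mul_exp hr s).symm)
  have h2 : ∫ s, 2 * r / (r ^ 2 + s ^ 2) ∂μ ≤ ∫ β, ‖charFun μ β‖ := by
    rw [integral_complex_ofReal] at h1
    have h3 := (le_abs_self _).trans_eq ((Complex.norm_real _).symm.trans (congrArg norm h1))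
    refine h3.trans (norm_integral_le_of_norm_le hint.norm (ae_of_all _ fun β => ?_))
    rw [norm_mul, Complex.norm_real, Real.norm_of_nonneg (Real.exp_pos _).le]
    exact mul_le_of_le_one_left (norm_nonneg _) (Real.exp_le_one_iff.2 (by
      have := mul_nonneg hr.le (abs_nonneg β); linarith))
  have hm : MeasurableSet {s : ℝ | |s| ≤ r} := measurableSet_le (by fun_prop) (by fun_prop)
  -- On `|s| ≤ r` the kernel `2r/(r² + s²)` is at least `1/r`, so its mean controls the mass of the
  -- ball.
  have h4 : ∫ s, Set.indicator {s : ℝ | |s| ≤ r} (fun _ => 1 / r) s ∂μ ≤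
      ∫ s, 2 * r / (r ^ 2 + s ^ 2) ∂μ := by
    refine integral_mono_of_nonneg (ae_of_all _ fun s => ?_) ?_ (ae_of_all _ fun s => ?_)
    · exact Set.indicator_nonneg (fun _ _ => by positivity) _
    · refine Integrable.of_bound (C := 2 / r) (Measurable.aestronglyMeasurable (by fun_prop))
        (ae_of_all _ fun s => ?_)
      rw [Real.norm_of_nonneg (by positivity), div_le_div_iff₀ (by positivity) hr]
      nlinarith [sq_nonneg s]
    · refine Set.indicator_le' (f := fun _ => 1 / r) (g := fun s => 2 * r / (r ^ 2 + s ^ 2))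
        (fun x hx => ?_) (fun x _ => by positivity) s
      have : x ^ 2 ≤ r ^ 2 := sq_le_sq' (abs_le.1 hx).1 (abs_le.1 hx).2
      rw [div_le_div_iff₀ hr (by positivity)]
      nlinarith
  rw [integral_indicator hm, setIntegral_const, smul_eq_mul] at h4
  have := h4.trans h2
  rw [mul_one_div, div_le_iff₀ hr] at this
  exact this

theorem measure_singleton_zero_of_abs_le {μ : Measure ℝ} [IsProbabilityMeasure μ] {C : ℝ}
    (h : ∀ r : ℝ, 0 < r → μ.real {s | |s| ≤ r} ≤ C * r) : μ {0} = 0 := by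
  have h1 : μ.real {0} ≤ 0 := by
    have hlim : Tendsto (fun r : ℝ => C * r) (𝓝[>] 0) (𝓝 0) := by
      have : Tendsto (fun r : ℝ => C * r) (𝓝 0) (𝓝 (C * 0)) := tendsto_id.const_mul C
      rw [mul_zero] at this
      exact this.mono_left nhdsWithin_le_nhds
    refine ge_of_tendsto hlim ?_
    filter_upwards [self_mem_nhdsWithin] with r hr
    refine (measureReal_mono ?_).trans (h r hr)
    simpa using (Set.mem_Ioi.1 hr).le
  have := le_antisymm h1 measureReal_nonneg
  exact (measureReal_eq_zero_iff).1 this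

/-- Layer-cake formula: the set where `|s|^{-γ} > u` lies in the ball of radius `u^{-1/γ}`, and
`u^{-1/γ}` is integrable at infinity because `γ < 1`. Levels `u ≤ 1` cost at most 1. -/
theorem integrable_abs_rpow_neg_of_abs_le {μ : Measure ℝ} [IsProbabilityMeasure μ] {C γ : ℝ}
    (h : ∀ r : ℝ, 0 < r → μ.real {s | |s| ≤ r} ≤ C * r) (hγ : 0 < γ) (hγ1 : γ < 1) :
    Integrable (fun s : ℝ => |s| ^ (-γ)) μ := by
  have hm : Measurable fun s : ℝ => |s| ^ (-γ) := by fun_prop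
  have hnn : ∀ s : ℝ, 0 ≤ |s| ^ (-γ) := fun s => Real.rpow_nonneg (abs_nonneg _) _
  refine (lintegral_ofReal_ne_top_iff_integrable hm.aestronglyMeasurable (ae_of_all _ hnn)).1 ?_
  rw [lintegral_eq_lintegral_meas_lt μ (ae_of_all _ hnn) hm.aemeasurable,
    ← Set.Ioc_union_Ioi_eq_Ioi zero_le_one,
    lintegral_union measurableSet_Ioi (Set.Ioc_disjoint_Ioi le_rfl)]
  refine ENNReal.add_ne_top.2 ⟨?_, ?_⟩
  · refine ne_top_of_le_ne_top (b := ∫⁻ _ in Set.Ioc (0 : ℝ) 1, 1) (by simp)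
      (lintegral_mono fun u => prob_le_one)
  · have hi : IntegrableOn (fun u : ℝ => C * u ^ (-γ⁻¹)) (Set.Ioi 1) :=
      (integrableOn_Ioi_rpow_of_lt (by
        have := (one_lt_inv₀ hγ).2 hγ1
        linarith) one_pos).const_mul C
    refine ne_top_of_le_ne_top (b := ∫⁻ u in Set.Ioi (1 : ℝ), ENNReal.ofReal (C * u ^ (-γ⁻¹)))
      hi.lintegral_lt_top.ne (setLIntegral_mono' measurableSet_Ioi fun u hu => ?_)
    have hu0 : (0 : ℝ) < u := one_pos.trans hu
    refine (measure_mono (t := {s : ℝ | |s| ≤ u ^ (-γ⁻¹)}) fun s hs => ?_).trans ?_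
    · simp only [Set.mem_ofPred_eq] at hs ⊢
      rcases (abs_nonneg s).eq_or_lt with h0 | h0
      · rw [← h0]
        positivity
      · by_contra! hlt
        have := Real.rpow_le_rpow_of_nonpos (by positivity) hlt.le (neg_nonpos.2 hγ.le)
        rw [← Real.rpow_mul hu0.le, neg_mul_neg, inv_mul_cancel₀ hγ.ne', Real.rpow_one] at this
        linarith
    · rw [← ofReal_measureReal]
      exact ENNReal.ofReal_le_ofReal (h _ (by positivity))

/-! ### Positivity of the stable law by contour shift -/

/-- Multiplying the argument by `α ≤ 1` does not leave the sector `|arg| ≤ π/2`. This bounds the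
continued characteristic function by 1. -/
theorem re_cpow_nonneg {w : ℂ} (hw : 0 ≤ w.re) {α : ℝ} (hα : 0 ≤ α) (hα1 : α ≤ 1) :
    0 ≤ (w ^ (α : ℂ)).re := by
  rw [Complex.cpow_ofReal_re]
  have h1 := Complex.abs_arg_le_pi_div_two_iff.2 hw
  have h2 : |w.arg * α| ≤ Real.pi / 2 := by
    rw [abs_mul, abs_of_nonneg hα]
    exact (mul_le_of_le_one_right (abs_nonneg _) hα1).trans h1
  exact mul_nonneg (Real.rpow_nonneg (norm_nonneg _) _)
    (Real.cos_nonneg_of_mem_Icc (abs_le.1 h2))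

/-- For `β ≠ 0` the argument of `-iβ` is `-(π/2) sgn β`, so with skewness parameter equal to `α` the
exponent is a principal power. It extends holomorphically to `Im z > 0`, where `-iz` has positive
real part. -/
theorem stableCharFun_eq_exp_cpow {α : ℝ} (hα : 0 < α) (t β : ℝ) :
    stableCharFun α α t β = Complex.exp (-t * (-(Complex.I * β)) ^ (α : ℂ)) := by
  rw [stableCharFun, Complex.cpow_ofReal, norm_neg, norm_mul, Complex.norm_I, one_mul,
    Complex.norm_real, Real.norm_eq_abs]
  have harg : (|β| ^ α : ℝ) * Complex.exp (-Complex.I * ((Real.pi * α / 2 * Real.sign β : ℝ) : ℂ)) =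
      ((|β| ^ α : ℝ) : ℂ) * (Real.cos ((-(Complex.I * β)).arg * α) +
        Real.sin ((-(Complex.I * β)).arg * α) * Complex.I) := by
    have key : ∀ θ : ℝ, Complex.exp (-Complex.I * (θ : ℂ)) =
        Real.cos (-θ) + Real.sin (-θ) * Complex.I := fun θ => by
      rw [Complex.ofReal_cos, Complex.ofReal_sin, ← Complex.exp_mul_I]
      congr 1
      push_cast
      ring
    rw [key]
    rcases lt_trichotomy β 0 with h | h | h
    · have : -(Complex.I * (β : ℂ)) = ((-β : ℝ) : ℂ) * Complex.I := by push_cast; ring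
      rw [this, Complex.arg_real_mul _ (by linarith), Complex.arg_I, Real.sign_of_neg h]
      congr <;> ring
    · simp [h, Real.zero_rpow hα.ne']
    · have : -(Complex.I * (β : ℂ)) = (β : ℂ) * (-Complex.I) := by ring
      rw [this, Complex.arg_real_mul _ h, Complex.arg_neg_I, Real.sign_of_pos h]
      congr <;> ring
  rw [← harg]
  congr 1
  push_cast
  ring

theorem one_add_norm_sq_le_norm_one_add_sq {w : ℂ} (hw : 0 ≤ w.re) : 1 + ‖w‖ ^ 2 ≤ ‖1 + w‖ ^ 2 := by
  rw [← Complex.normSq_eq_norm_sq, ← Complex.normSq_eq_norm_sq, Complex.normSq_apply,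
    Complex.normSq_apply]
  simp
  nlinarith

/-- The extension of `β ↦ (1 - iβ)⁻² exp(-t(-iβ)^α)` to the upper half plane. -/
noncomputable def halfPlaneKernel (α t : ℝ) (z : ℂ) : ℂ :=
  ((1 + -(Complex.I * z)) ^ 2)⁻¹ * Complex.exp (-t * (-(Complex.I * z)) ^ (α : ℂ))

theorem one_add_ne_zero_of_re_nonneg {w : ℂ} (hw : 0 ≤ w.re) : 1 + w ≠ 0 := fun h => by
  have := congrArg Complex.re h
  simp at this
  linarith

theorem norm_halfPlaneKernel_le {α t : ℝ} (hα : 0 ≤ α) (hα1 : α ≤ 1) (ht : 0 ≤ t) {z : ℂ}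
    (hz : 0 ≤ z.im) : ‖halfPlaneKernel α t z‖ ≤ (1 + ‖z‖ ^ 2)⁻¹ := by
  have hw : 0 ≤ (-(Complex.I * z)).re := by simpa using hz
  have h1 := one_add_norm_sq_le_norm_one_add_sq hw
  rw [norm_neg, norm_mul, Complex.norm_I, one_mul] at h1
  have h2 := re_cpow_nonneg hw hα hα1
  have h3 : ‖Complex.exp (-t * (-(Complex.I * z)) ^ (α : ℂ))‖ ≤ 1 := by
    rw [Complex.norm_exp, Real.exp_le_one_iff, ← Complex.ofReal_neg, Complex.re_ofReal_mul]
    nlinarith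
  rw [halfPlaneKernel, norm_mul, norm_inv, norm_pow]
  refine (mul_le_of_le_one_right (by positivity) h3).trans (inv_anti₀ (by positivity) h1)

theorem continuousAt_halfPlaneKernel {α t : ℝ} (hα : 0 < α) {z : ℂ} (hz : 0 ≤ z.im) :
    ContinuousAt (halfPlaneKernel α t) z := by
  have hw : 0 ≤ (-(Complex.I * z)).re := by simpa using hz
  have h1 : ContinuousAt (fun z : ℂ => -(Complex.I * z)) z := by fun_prop
  have h2 : ContinuousAt (fun z : ℂ => (-(Complex.I * z)) ^ (α : ℂ)) z :=
    ContinuousAt.comp (f := fun z : ℂ => -(Complex.I * z))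
      (Complex.continuousAt_cpow_const_of_re_pos (Or.inl hw) (by simpa using hα)) h1
  exact (((continuousAt_const.add h1).pow 2).inv₀
    (pow_ne_zero 2 (one_add_ne_zero_of_re_nonneg hw))).mul
      ((continuousAt_const.mul h2).cexp)

theorem differentiableAt_halfPlaneKernel {α t : ℝ} {z : ℂ} (hz : 0 < z.im) :
    DifferentiableAt ℂ (halfPlaneKernel α t) z := by
  have hw : 0 < (-(Complex.I * z)).re := by simpa using hz
  have h1 : DifferentiableAt ℂ (fun z : ℂ => -(Complex.I * z)) z := by fun_prop
  have h2 : DifferentiableAt ℂ (fun z : ℂ => (-(Complex.I * z)) ^ (α : ℂ)) z :=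
    h1.cpow (differentiableAt_const _) (Or.inl hw)
  exact ((((differentiableAt_const 1).add h1).pow 2).inv
    (pow_ne_zero 2 (one_add_ne_zero_of_re_nonneg hw.le))).mul
      (((differentiableAt_const _).mul h2).cexp)

theorem integrable_halfPlaneKernel {α t : ℝ} (hα : 0 < α) (hα1 : α ≤ 1) (ht : 0 ≤ t) :
    Integrable fun β : ℝ => halfPlaneKernel α t β := by
  have hc : Continuous fun β : ℝ => halfPlaneKernel α t β :=
    continuous_iff_continuousAt.2 fun β => ContinuousAt.comp (f := fun β : ℝ => (β : ℂ))
      (continuousAt_halfPlaneKernel hα (by simp)) Complex.continuous_ofReal.continuousAt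
  refine integrable_inv_one_add_sq.mono' hc.aestronglyMeasurable (ae_of_all _ fun β => ?_)
  have := norm_halfPlaneKernel_le hα.le hα1 ht (z := (β : ℂ)) (by simp)
  rwa [Complex.norm_real, Real.norm_eq_abs, sq_abs] at this

/-- Cauchy's theorem in the upper half plane. -/
theorem integral_halfPlaneKernel_eq_zero {α t : ℝ} (hα : 0 < α) (hα1 : α ≤ 1) (ht : 0 ≤ t) :
    ∫ β : ℝ, halfPlaneKernel α t β = 0 := by
  have hlim := intervalIntegral_tendsto_integral (integrable_halfPlaneKernel hα hα1 ht)
    tendsto_neg_atTop_atBot tendsto_id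
  -- The other three sides of the rectangle have total length `4R`, and the integrand is at most
  -- `R⁻²` on them.
  refine tendsto_nhds_unique hlim (squeeze_zero_norm' (a := fun R : ℝ => 4 / R) ?_
    (tendsto_const_nhds.div_atTop tendsto_id))
  filter_upwards [eventually_gt_atTop 0] with R hR
  have hbd : ∀ z : ℂ, 0 ≤ z.im → R ≤ ‖z‖ → ‖halfPlaneKernel α t z‖ ≤ (R ^ 2)⁻¹ := fun z hz hzR =>
    (norm_halfPlaneKernel_le hα.le hα1 ht hz).trans (inv_anti₀ (by positivity) (by nlinarith))
  -- The branch point 0 lies on the bottom edge, hence a form of Cauchy's theorem that asks only for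
  -- continuity up to the boundary.
  have hrect := Complex.integral_boundary_rect_eq_zero_of_continuousOn_of_differentiableOn
    (halfPlaneKernel α t) (-R : ℂ) (R + R * Complex.I)
    (fun z hz => (continuousAt_halfPlaneKernel hα (by
      have := hz.2
      simp only [Set.mem_preimage] at this
      simp [Set.uIcc_of_le hR.le] at this
      exact this.1)).continuousWithinAt)
    (fun z hz => (differentiableAt_halfPlaneKernel (by
      have := hz.2
      simp only [Set.mem_preimage] at this
      simp [hR.le] at this
      exact this.1)).differentiableWithinAt)
  simp only [Complex.neg_re, Complex.ofReal_re, Complex.neg_im, Complex.ofReal_im, neg_zero,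
    Complex.add_re, Complex.mul_re, Complex.I_re, mul_zero, Complex.I_im, mul_one, sub_self,
    add_zero, Complex.add_im, Complex.mul_im, zero_add, Complex.ofReal_zero, zero_mul,
    smul_eq_mul] at hrect
  have b1 : ‖∫ x in (-R)..R, halfPlaneKernel α t (x + R * Complex.I)‖ ≤ (R ^ 2)⁻¹ * |R - -R| := by
    refine intervalIntegral.norm_integral_le_of_norm_le_const fun x _ => hbd _ (by simp [hR.le]) ?_
    simpa [abs_of_pos hR] using Complex.abs_im_le_norm (x + R * Complex.I)
  have b2 : ∀ r : ℝ, |r| = R →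
      ‖∫ y in (0 : ℝ)..R, halfPlaneKernel α t (r + y * Complex.I)‖ ≤ (R ^ 2)⁻¹ * |R - 0| := by
    intro r hr
    refine intervalIntegral.norm_integral_le_of_norm_le_const fun y hy => hbd _ ?_ ?_
    · rw [Set.uIoc_of_le hR.le] at hy
      simpa using hy.1.le
    · simpa [hr] using Complex.abs_re_le_norm (r + y * Complex.I)
  have b3 := b2 R (abs_of_pos hR)
  have b4 := b2 (-R) (by rw [abs_neg, abs_of_pos hR])
  have heq : ∫ x in (-R)..R, halfPlaneKernel α t x =
      (∫ x in (-R)..R, halfPlaneKernel α t (x + R * Complex.I)) -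
        Complex.I * (∫ y in (0 : ℝ)..R, halfPlaneKernel α t (R + y * Complex.I)) +
        Complex.I * (∫ y in (0 : ℝ)..R, halfPlaneKernel α t ((-R : ℝ) + y * Complex.I)) := by
    linear_combination hrect
  simp only [id]
  rw [heq]
  refine (norm_add_le _ _).trans ((add_le_add_left (norm_sub_le _ _) _).trans ?_)
  rw [norm_mul, norm_mul, Complex.norm_I, one_mul, one_mul]
  rw [sub_neg_eq_add, abs_of_pos (by linarith)] at b1
  rw [sub_zero, abs_of_pos hR] at b3 b4
  have : 4 / R = (R ^ 2)⁻¹ * (R + R) + (R ^ 2)⁻¹ * R + (R ^ 2)⁻¹ * R := by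
    field_simp
    norm_num
  rw [this]
  exact add_le_add (add_le_add b1 b3) b4

theorem hasDerivAt_mul_cexp_neg_mul {a : ℂ} (ha : a ≠ 0) (x : ℝ) :
    HasDerivAt (fun x : ℝ => -((x : ℂ) / a + 1 / a ^ 2) * Complex.exp (-a * x))
      (x * Complex.exp (-a * x)) x := by
  have h1 : HasDerivAt (fun x : ℝ => (x : ℂ)) 1 x := Complex.ofRealCLM.hasDerivAt
  have h2 := (((h1.div_const a).add_const (1 / a ^ 2)).neg).mul ((h1.const_mul (-a)).cexp)
  refine h2.congr_deriv ?_
  simp only [Pi.neg_apply]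
  field_simp
  ring

theorem integrableOn_mul_cexp_neg_mul {a : ℂ} (ha : 0 < a.re) :
    IntegrableOn (fun x : ℝ => (x : ℂ) * Complex.exp (-a * x)) (Set.Ioi 0) := by
  have h := integrableOn_rpow_mul_exp_neg_mul_rpow (s := 1) (p := 1) (by norm_num) one_pos ha
  refine h.mono' (by fun_prop) ?_
  filter_upwards [ae_restrict_mem measurableSet_Ioi] with x hx
  rw [norm_mul, Complex.norm_real, Real.norm_of_nonneg (le_of_lt hx), Complex.norm_exp]
  simp

theorem integral_mul_cexp_neg_mul {a : ℂ} (ha : 0 < a.re) :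
    ∫ x in Set.Ioi (0 : ℝ), (x : ℂ) * Complex.exp (-a * x) = (a ^ 2)⁻¹ := by
  have ha0 : a ≠ 0 := fun h => by simp [h] at ha
  have hlim : Tendsto (fun x : ℝ => -((x : ℂ) / a + 1 / a ^ 2) * Complex.exp (-a * x))
      atTop (𝓝 0) := by
    have e0 : ∀ n : ℕ, Tendsto (fun x : ℝ => (x : ℂ) ^ n * Complex.exp (-a * x)) atTop (𝓝 0) := by
      intro n
      have := tendsto_rpow_mul_exp_neg_mul_atTop_nhds_zero n a.re ha
      simp only [Real.rpow_natCast] at this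
      refine squeeze_zero_norm' ?_ this
      filter_upwards [eventually_ge_atTop 0] with x hx
      rw [norm_mul, norm_pow, Complex.norm_real, Real.norm_of_nonneg hx, Complex.norm_exp]
      simp
    have := ((e0 1).const_mul (-(1 / a))).add ((e0 0).const_mul (-(1 / a ^ 2)))
    rw [mul_zero, mul_zero, add_zero] at this
    refine this.congr fun x => ?_
    ring
  rw [integral_Ioi_of_hasDerivAt_of_tendsto' (fun x _ => hasDerivAt_mul_cexp_neg_mul ha0 x)
    (integrableOn_mul_cexp_neg_mul ha) hlim]
  simp

/-- The density of the Gamma distribution with shape `2`. -/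
noncomputable def gammaTwoDensity (x : ℝ) : ℝ := max x 0 * Real.exp (-x)

theorem continuous_gammaTwoDensity : Continuous gammaTwoDensity := by
  unfold gammaTwoDensity
  fun_prop

theorem gammaTwoDensity_of_nonpos {x : ℝ} (hx : x ≤ 0) : gammaTwoDensity x = 0 := by
  rw [gammaTwoDensity, max_eq_right hx, zero_mul]

theorem gammaTwoDensity_nonneg (x : ℝ) : 0 ≤ gammaTwoDensity x :=
  mul_nonneg (le_max_right _ _) (Real.exp_pos _).le

theorem gammaTwoDensity_le_one (x : ℝ) : gammaTwoDensity x ≤ 1 := by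
  rcases le_total x 0 with hx | hx
  · rw [gammaTwoDensity_of_nonpos hx]
    exact zero_le_one
  · rw [gammaTwoDensity, max_eq_left hx, Real.exp_neg, ← div_eq_mul_inv, div_le_one (Real.exp_pos _)]
    linarith [Real.add_one_le_exp x]

theorem integral_cexp_mul_gammaTwoDensity (y : ℝ) :
    ∫ x : ℝ, Complex.exp (y * x * Complex.I) * (gammaTwoDensity x : ℂ) =
      ((1 + -(Complex.I * y)) ^ 2)⁻¹ := by
  rw [← setIntegral_eq_integral_of_forall_compl_eq_zero (s := Set.Ioi 0) (fun x hx => by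
    rw [gammaTwoDensity_of_nonpos (by simpa using hx), Complex.ofReal_zero, mul_zero]),
    ← integral_mul_cexp_neg_mul (a := 1 + -(Complex.I * y)) (by simp)]
  refine setIntegral_congr_fun measurableSet_Ioi fun x hx => ?_
  rw [Set.mem_Ioi] at hx
  rw [gammaTwoDensity, max_eq_left hx.le, Complex.ofReal_mul, Complex.ofReal_exp,
    mul_left_comm, ← Complex.exp_add]
  congr 2
  push_cast
  ring

theorem integrable_gammaTwoDensity : Integrable gammaTwoDensity := by
  have h := integrableOn_rpow_mul_exp_neg_mul_rpow (s := 1) (p := 1) (b := 1) (by norm_num)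
    one_pos one_pos
  rw [← integrableOn_univ, ← Set.Iic_union_Ioi (a := (0 : ℝ))]
  refine IntegrableOn.union ?_ ?_
  · exact integrableOn_zero.congr_fun (fun x hx => (gammaTwoDensity_of_nonpos hx).symm)
      measurableSet_Iic
  · refine h.congr_fun (fun x hx => ?_) measurableSet_Ioi
    rw [Set.mem_Ioi] at hx
    simp [gammaTwoDensity, hx.le]

theorem integrable_inv_one_sub_I_mul_sq :
    Integrable fun y : ℝ => ((1 + -(Complex.I * y)) ^ 2)⁻¹ := by
  have := integrable_halfPlaneKernel (α := 1) (t := 0) one_pos le_rfl le_rfl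
  refine this.congr (ae_of_all _ fun y => ?_)
  simp [halfPlaneKernel]

/-- Fourier inversion for the Gamma distribution with shape `2`. -/
theorem integral_inv_sq_mul_cexp (s : ℝ) :
    ∫ y : ℝ, ((1 + -(Complex.I * y)) ^ 2)⁻¹ * Complex.exp (y * s * Complex.I) =
      ((2 * Real.pi * gammaTwoDensity (-s) : ℝ) : ℂ) := by
  have hπ := Real.pi_pos
  let f : ℝ → ℂ := fun x => (gammaTwoDensity x : ℂ)
  have hf : Continuous f := Complex.continuous_ofReal.comp continuous_gammaTwoDensity
  -- The Fourier transform here uses `e^{-2πixw}`, so the frequency is `y = -2πw`.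
  have hF : ∀ w : ℝ, FourierTransform.fourier f w =
      ((1 + -(Complex.I * ((w * (-2 * Real.pi) : ℝ) : ℂ))) ^ 2)⁻¹ := fun w => by
    rw [Real.fourier_real_eq_integral_exp_smul, ← integral_cexp_mul_gammaTwoDensity]
    simp only [smul_eq_mul, f]
    congr with x
    congr 3
    push_cast
    ring
  have hFi : Integrable (FourierTransform.fourier f) := by
    rw [funext hF]
    exact integrable_inv_one_sub_I_mul_sq.comp_mul_right' (R := -2 * Real.pi) (by
      simp [hπ.ne'])
  have hinv := congrFun (hf.fourierInv_fourier_eq integrable_gammaTwoDensity.ofReal hFi) (-s)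
  rw [Real.fourierInv_eq'] at hinv
  simp_rw [hF] at hinv
  have hsub := Measure.integral_comp_mul_right (fun y : ℝ =>
    ((1 + -(Complex.I * y)) ^ 2)⁻¹ * Complex.exp (y * s * Complex.I)) (-2 * Real.pi)
  have h2 : |(-2 * Real.pi)⁻¹| = (2 * Real.pi)⁻¹ := by
    rw [abs_inv, abs_of_neg (by linarith)]
    ring_nf
  rw [h2] at hsub
  have h3 : (f (-s)) = ((2 * Real.pi)⁻¹ : ℝ) • ∫ y : ℝ,
      ((1 + -(Complex.I * y)) ^ 2)⁻¹ * Complex.exp (y * s * Complex.I) := by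
    rw [← hsub, ← hinv]
    congr with w
    rw [smul_eq_mul, mul_comm]
    congr 2
    simp only [RCLike.inner_apply, conj_trivial]
    push_cast
    ring
  rw [Complex.ofReal_mul]
  change _ = _ * f (-s)
  rw [h3, Complex.real_smul, ← mul_assoc, ← Complex.ofReal_mul, mul_inv_cancel₀ (by positivity),
    Complex.ofReal_one, one_mul]

/-- A positively skewed stable law of index `α < 1` is carried by `[0, ∞)`. -/
theorem ae_nonneg_of_charFun_eq_stableCharFun {μ : Measure ℝ} [IsProbabilityMeasure μ] {α t : ℝ}
    (hα : 0 < α) (hα1 : α ≤ 1) (ht : 0 ≤ t) (hμ : ∀ β, charFun μ β = stableCharFun α α t β) :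
    ∀ᵐ s ∂μ, 0 ≤ s := by
  -- Paired with `μ`, the inversion formula turns `2π ∫ gammaTwoDensity (-s) ∂μ` into the integral
  -- of `halfPlaneKernel`, which vanishes. The integrand is nonnegative, and positive exactly for `s
  -- < 0`.
  have h1 := integral_integral_mul_exp_eq_integral_mul_charFun μ integrable_inv_one_sub_I_mul_sq
    measurable_id
  simp only [id] at h1
  simp_rw [integral_inv_sq_mul_cexp, hμ, stableCharFun_eq_exp_cpow hα] at h1
  have h2 := h1.trans (integral_halfPlaneKernel_eq_zero hα hα1 ht)
  rw [integral_complex_ofReal, Complex.ofReal_eq_zero, integral_const_mul] at h2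
  have h3 : ∫ s, gammaTwoDensity (-s) ∂μ = 0 :=
    (mul_eq_zero.1 h2).resolve_left (by positivity)
  have hi : Integrable (fun s => gammaTwoDensity (-s)) μ := by
    refine Integrable.of_bound (C := 1)
      (continuous_gammaTwoDensity.comp continuous_neg).aestronglyMeasurable
      (ae_of_all _ fun s => ?_)
    rw [Real.norm_of_nonneg (gammaTwoDensity_nonneg _)]
    exact gammaTwoDensity_le_one _
  filter_upwards [(integral_eq_zero_iff_of_nonneg (fun s => gammaTwoDensity_nonneg _) hi).1 h3]
    with s hs
  by_contra! hlt
  rw [Pi.zero_apply, gammaTwoDensity, max_eq_left (by linarith)] at hs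
  have : 0 < -s * Real.exp (- -s) := mul_pos (by linarith) (Real.exp_pos _)
  linarith

/-! ### The Cauchy density and its differential equation -/

theorem cauchyAngle_pos (k : ℕ) : 0 < cauchyAngle k := by
  unfold cauchyAngle
  positivity

theorem cos_cauchyAngle_pos {k : ℕ} (hk : 1 ≤ k) : 0 < Real.cos (cauchyAngle k) := by
  refine Real.cos_pos_of_mem_Ioo ⟨by linarith [cauchyAngle_pos k, Real.pi_pos], ?_⟩
  have : (1 : ℝ) ≤ k := by exact_mod_cast hk
  rw [cauchyAngle, div_lt_div_iff_of_pos_left Real.pi_pos (by positivity) (by positivity)]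
  linarith

/-- The unimodular number `e^{-i(-1)^k φ_k}`. -/
noncomputable def cauchyPhase (k : ℕ) : ℂ :=
  Complex.exp (((-((-1) ^ k * cauchyAngle k) : ℝ) : ℂ) * Complex.I)

theorem sin_neg_one_pow_mul (k : ℕ) (θ : ℝ) : Real.sin ((-1) ^ k * θ) = (-1) ^ k * Real.sin θ := by
  rcases neg_one_pow_eq_or ℝ k with h | h <;> simp [h]

theorem cos_neg_one_pow_mul (k : ℕ) (θ : ℝ) : Real.cos ((-1) ^ k * θ) = Real.cos θ := by
  rcases neg_one_pow_eq_or ℝ k with h | h <;> simp [h]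

theorem cauchyPhase_re (k : ℕ) : (cauchyPhase k).re = Real.cos (cauchyAngle k) := by
  rw [cauchyPhase, Complex.exp_ofReal_mul_I_re, Real.cos_neg, cos_neg_one_pow_mul]

theorem cauchyPhase_im (k : ℕ) : (cauchyPhase k).im = -((-1) ^ k * Real.sin (cauchyAngle k)) := by
  rw [cauchyPhase, Complex.exp_ofReal_mul_I_im, Real.sin_neg, sin_neg_one_pow_mul]

/-- `(2k+1) φ_k = π/2`, so the power is `e^{-i(-1)^k π/2} = -(-1)^k i`. This identity is what makes
the derivatives in `t` and `x` cancel. -/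
theorem cauchyPhase_pow (k : ℕ) : cauchyPhase k ^ (2 * k + 1) = -Complex.I ^ (2 * k + 1) := by
  rw [cauchyPhase, ← Complex.exp_nat_mul, pow_succ, pow_mul, Complex.I_sq]
  have : ((2 * k + 1 : ℕ) : ℂ) * (((-((-1) ^ k * cauchyAngle k) : ℝ) : ℂ) * Complex.I) =
      ((-((-1) ^ k * (Real.pi / 2)) : ℝ) : ℂ) * Complex.I := by
    have h : (2 * (k : ℂ) + 1) ≠ 0 := by exact_mod_cast Nat.succ_ne_zero (2 * k)
    rw [cauchyAngle]
    push_cast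
    field_simp
  rw [this]
  apply Complex.ext
  · rw [Complex.exp_ofReal_mul_I_re, Real.cos_neg, cos_neg_one_pow_mul, Real.cos_pi_div_two]
    rcases neg_one_pow_eq_or ℂ k with h | h <;> simp [h]
  · rw [Complex.exp_ofReal_mul_I_im, Real.sin_neg, sin_neg_one_pow_mul, Real.sin_pi_div_two]
    rcases Nat.even_or_odd k with h | h <;> simp [h]

/-- As the real part of the inverse of an affine form, the density can be differentiated to any
order in closed form. -/
theorem asymCauchyDensity_eq_re (k : ℕ) (x t : ℝ) :
    asymCauchyDensity k x t = Real.pi⁻¹ * ((t * cauchyPhase k + Complex.I * x)⁻¹).re := by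
  rw [asymCauchyDensity, Complex.inv_re, Complex.normSq_apply]
  have h1 : (t * cauchyPhase k + Complex.I * x).re = t * Real.cos (cauchyAngle k) := by
    simp [cauchyPhase_re]
  have h2 : (t * cauchyPhase k + Complex.I * x).im =
      x + (-1) ^ (k + 1) * t * Real.sin (cauchyAngle k) := by
    simp [cauchyPhase_im]
    ring
  rw [h1, h2, div_mul_eq_div_div_swap, inv_mul_eq_div]
  congr 2
  ring

theorem iteratedDeriv_re_inv_affine (c : ℝ) (a b : ℂ) (m : ℕ) (τ : ℝ) (hτ : a * τ + b ≠ 0) :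
    iteratedDeriv m (fun τ : ℝ => c * ((a * τ + b)⁻¹).re) τ =
      c * ((-1) ^ m * m.factorial * a ^ m * ((a * τ + b) ^ (m + 1))⁻¹).re := by
  induction m generalizing τ with
  | zero => simp
  | succ m ih =>
    -- The induction hypothesis holds only off the zero of the affine form, so it is differentiated
    -- on a neighbourhood.
    have hopen : ∀ᶠ τ' : ℝ in 𝓝 τ, a * τ' + b ≠ 0 := by
      have : ContinuousAt (fun τ' : ℝ => a * (τ' : ℂ) + b) τ := by fun_prop
      exact this.eventually_ne hτ
    rw [iteratedDeriv_succ, Filter.EventuallyEq.deriv_eq (hopen.mono fun τ' h => ih τ' h)]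
    have h1 : HasDerivAt (fun τ : ℝ => (τ : ℂ)) 1 τ := Complex.ofRealCLM.hasDerivAt
    have h2 := ((((h1.const_mul a).add_const b).pow (m + 1)).inv (pow_ne_zero _ hτ)).const_mul
      ((-1) ^ m * m.factorial * a ^ m)
    have h3 := (Complex.reCLM.hasFDerivAt.comp_hasDerivAt τ h2).const_mul c
    refine Eq.trans h3.deriv ?_
    rw [Complex.reCLM_apply]
    congr 2
    rw [Nat.factorial_succ]
    push_cast
    simp only [Pi.pow_apply]
    field_simp
    ring

theorem affine_cauchyPhase_ne_zero {k : ℕ} (hk : 1 ≤ k) (x : ℝ) {t : ℝ} (ht : 0 < t) :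
    t * cauchyPhase k + Complex.I * x ≠ 0 := fun h => by
  have := congrArg Complex.re h
  simp [cauchyPhase_re, ht.ne', (cos_cauchyAngle_pos hk).ne'] at this

theorem asymCauchyDensity_higherOrderLaplace {k : ℕ} (hk : 1 ≤ k) (x : ℝ) {t : ℝ} (ht : 0 < t) :
    iteratedDeriv (2 * k + 1) (fun τ => asymCauchyDensity k x τ) t +
      iteratedDeriv (2 * k + 1) (fun y => asymCauchyDensity k y t) x = 0 := by
  have hne := affine_cauchyPhase_ne_zero hk x ht
  have e1 : (fun τ => asymCauchyDensity k x τ) =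
      fun τ : ℝ => Real.pi⁻¹ * ((cauchyPhase k * τ + Complex.I * x)⁻¹).re := by
    ext τ
    rw [asymCauchyDensity_eq_re, mul_comm (τ : ℂ)]
  have e2 : (fun y => asymCauchyDensity k y t) =
      fun y : ℝ => Real.pi⁻¹ * ((Complex.I * y + t * cauchyPhase k)⁻¹).re := by
    ext y
    rw [asymCauchyDensity_eq_re, add_comm (t * cauchyPhase k)]
  rw [e1, e2, iteratedDeriv_re_inv_affine _ _ _ _ _ (by rwa [mul_comm]),
    iteratedDeriv_re_inv_affine _ _ _ _ _ (by rwa [add_comm]), cauchyPhase_pow,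
    mul_comm (cauchyPhase k), add_comm (Complex.I * (x : ℂ)), ← mul_add, ← Complex.add_re]
  ring_nf
  simp

theorem asymCauchyDensity_denom_pos {k : ℕ} (hk : 1 ≤ k) (x : ℝ) {t : ℝ} (ht : 0 < t) :
    0 < Real.pi * ((x + (-1) ^ (k + 1) * t * Real.sin (cauchyAngle k)) ^ 2
      + t ^ 2 * Real.cos (cauchyAngle k) ^ 2) := by
  have := cos_cauchyAngle_pos hk
  positivity

theorem contDiffOn_asymCauchyDensity {k : ℕ} (hk : 1 ≤ k) :
    ContDiffOn ℝ ∞ (fun p : ℝ × ℝ => asymCauchyDensity k p.1 p.2) (Set.univ ×ˢ Set.Ioi 0) := by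
  unfold asymCauchyDensity
  refine ContDiffOn.div (by fun_prop) (by fun_prop) fun p hp =>
    (asymCauchyDensity_denom_pos hk p.1 hp.2).ne'

theorem cauchyMeasure_real_Icc {k : ℕ} (hk : 1 ≤ k) {t a b : ℝ} (ht : 0 < t) (hab : a ≤ b) :
    (cauchyMeasure ((-1) ^ k * t * Real.sin (cauchyAngle k))
      (Real.toNNReal (t * Real.cos (cauchyAngle k)))).real (Set.Icc a b) =
      ∫ x in a..b, asymCauchyDensity k x t := by
  have hpos : 0 < t * Real.cos (cauchyAngle k) := mul_pos ht (cos_cauchyAngle_pos hk)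
  rw [cauchyMeasure_of_scale_ne_zero _ (Real.toNNReal_pos.2 hpos).ne', measureReal_def,
    withDensity_apply _ measurableSet_Icc, intervalIntegral.integral_of_le hab,
    ← integral_Icc_eq_integral_Ioc]
  unfold cauchyPDF
  rw [← integral_eq_lintegral_of_nonneg_ae (ae_of_all _ fun x =>
      (cauchyPDF_pos _ (Real.toNNReal_pos.2 hpos).ne' x).le)
    (stronglyMeasurable_cauchyPDFReal _ _).aestronglyMeasurable]
  refine setIntegral_congr_fun measurableSet_Icc fun x _ => ?_
  have := cos_cauchyAngle_pos hk
  rw [cauchyPDFReal_def, Real.coe_toNNReal _ hpos.le, asymCauchyDensity, pow_succ (-1 : ℝ) k,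
    mul_assoc, inv_mul_eq_div, ← div_eq_mul_inv, div_div]
  ring_nf

/-! ### The stable law averaged against the kernel -/

/-- The index undoes the odd power in modulus, `πα/2` is `φ_k`, and the sign `(-1)^k sgn β` affects
only the sine. -/
theorem stableCharFun_neg_one_pow_mul_pow (k : ℕ) (t β : ℝ) :
    stableCharFun (1 / (2 * (k : ℝ) + 1)) (1 / (2 * (k : ℝ) + 1)) t ((-1) ^ k * β ^ (2 * k + 1)) =
      Real.exp (-(t * Real.cos (cauchyAngle k) * |β|)) *
        Complex.exp (β * ((-1) ^ k * t * Real.sin (cauchyAngle k) : ℝ) * Complex.I) := by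
  have habs : |(-1) ^ k * β ^ (2 * k + 1)| ^ (1 / (2 * (k : ℝ) + 1)) = |β| := by
    have := Real.pow_rpow_inv_natCast (abs_nonneg β) (n := 2 * k + 1) (by omega)
    push_cast at this
    rw [abs_mul, abs_pow, abs_neg, abs_one, one_pow, one_mul, abs_pow, one_div, this]
  have hang : Real.pi * (1 / (2 * (k : ℝ) + 1)) / 2 = cauchyAngle k := by
    have : (2 * (k : ℝ) + 1) ≠ 0 := by positivity
    rw [cauchyAngle]
    field_simp
  have hsign : Real.sign ((-1) ^ k * β ^ (2 * k + 1)) = (-1) ^ k * Real.sign β := by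
    have hodd : Odd (2 * k + 1) := ⟨k, rfl⟩
    have h1 : Real.sign (β ^ (2 * k + 1)) = Real.sign β := by
      rcases lt_trichotomy β 0 with h | h | h
      · rw [Real.sign_of_neg h, Real.sign_of_neg (hodd.pow_neg h)]
      · simp [h]
      · rw [Real.sign_of_pos h, Real.sign_of_pos (pow_pos h _)]
    rcases neg_one_pow_eq_or ℝ k with h | h <;> simp [h, h1, Real.sign_neg]
  have hcos : Real.cos (cauchyAngle k * ((-1) ^ k * Real.sign β)) * |β| =
      Real.cos (cauchyAngle k) * |β| := by
    rw [mul_left_comm, cos_neg_one_pow_mul]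
    rcases lt_trichotomy β 0 with h | h | h
    · simp [Real.sign_of_neg h]
    · simp [h]
    · simp [Real.sign_of_pos h]
  have hsin : Real.sin (cauchyAngle k * ((-1) ^ k * Real.sign β)) * |β| =
      (-1) ^ k * Real.sin (cauchyAngle k) * β := by
    rw [mul_left_comm, sin_neg_one_pow_mul]
    rcases lt_trichotomy β 0 with h | h | h
    · simp [Real.sign_of_neg h, abs_of_neg h]
    · simp [h]
    · simp [Real.sign_of_pos h, abs_of_pos h]
  rw [stableCharFun, habs, hang, hsign]
  have hexp : ∀ θ : ℝ, Complex.exp (-Complex.I * (θ : ℂ)) =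
      Real.cos θ - Real.sin θ * Complex.I := fun θ => by
    have : -Complex.I * (θ : ℂ) = ((-θ : ℝ) : ℂ) * Complex.I := by push_cast; ring
    rw [this, Complex.exp_mul_I, ← Complex.ofReal_cos, ← Complex.ofReal_sin, Real.cos_neg,
      Real.sin_neg]
    push_cast
    ring
  rw [hexp, Complex.ofReal_exp, ← Complex.exp_add]
  congr 1
  have hcos' := congrArg (fun r : ℝ => (r : ℂ)) hcos
  have hsin' := congrArg (fun r : ℝ => (r : ℂ)) hsin
  simp only [Complex.ofReal_mul] at hcos' hsin'
  push_cast at hcos' hsin' ⊢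
  linear_combination -(t : ℂ) * hcos' + t * Complex.I * hsin'

section StableLaw

variable {k : ℕ} {t : ℝ} {μ : Measure ℝ} [IsProbabilityMeasure μ]

theorem integral_truncKernel (hμ : ∀ β, charFun μ β =
      stableCharFun (1 / (2 * (k : ℝ) + 1)) (1 / (2 * (k : ℝ) + 1)) t β) (x : ℝ) {R : ℝ}
    (hR : 0 ≤ R) :
    ∫ s, truncKernel k x s R ∂μ = (1 / (2 * (Real.pi : ℂ))) * ∫ β in (-R)..R,
      (Real.exp (-(t * Real.cos (cauchyAngle k) * |β|)) : ℂ) *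
        Complex.exp (β * ((-1) ^ k * t * Real.sin (cauchyAngle k) - x : ℝ) * Complex.I) := by
  have hle : -R ≤ R := by linarith
  have hint : Integrable (fun β : ℝ => Complex.exp (-Complex.I * (β : ℂ) * (x : ℂ)))
      (volume.restrict (Set.Ioc (-R) R)) := by
    have : Continuous fun β : ℝ => Complex.exp (-Complex.I * (β : ℂ) * (x : ℂ)) := by fun_prop
    exact this.integrableOn_Ioc
  have h := integral_integral_mul_exp_eq_integral_mul_charFun μ hint
    (θ := fun β => (-1) ^ k * β ^ (2 * k + 1)) (by fun_prop)
  simp_rw [truncKernel, integral_const_mul, intervalIntegral.integral_of_le hle]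
  congr 1
  refine Eq.trans ?_ (h.trans ?_)
  · congr with s
    congr with β
    congr 2
    push_cast
    ring
  · congr with β
    rw [hμ, stableCharFun_neg_one_pow_mul_pow, mul_left_comm, ← Complex.exp_add]
    congr 2
    push_cast
    ring

theorem tendsto_integral_truncKernel (hk : 1 ≤ k) (ht : 0 < t) (hμ : ∀ β, charFun μ β =
      stableCharFun (1 / (2 * (k : ℝ) + 1)) (1 / (2 * (k : ℝ) + 1)) t β) (x : ℝ) :
    Tendsto (fun R : ℝ => ∫ s, truncKernel k x s R ∂μ) atTop
      (𝓝 ((asymCauchyDensity k x t : ℝ) : ℂ)) := by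
  have hc : 0 < t * Real.cos (cauchyAngle k) := mul_pos ht (cos_cauchyAngle_pos hk)
  have hval := integral_exp_neg_mul_abs_mul_exp hc ((-1) ^ k * t * Real.sin (cauchyAngle k) - x)
  have hi : Integrable fun β : ℝ => (Real.exp (-(t * Real.cos (cauchyAngle k) * |β|)) : ℂ) *
        Complex.exp (β * ((-1) ^ k * t * Real.sin (cauchyAngle k) - x : ℝ) * Complex.I) := by
    refine (integrable_exp_neg_mul_abs hc).ofReal.mul_bdd (c := 1) (by fun_prop)
      (ae_of_all _ fun p => ?_)
    rw [← Complex.ofReal_mul, Complex.norm_exp_ofReal_mul_I]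
  have hlim := (intervalIntegral_tendsto_integral hi tendsto_neg_atTop_atBot
    tendsto_id).const_mul (1 / (2 * (Real.pi : ℂ)))
  rw [hval] at hlim
  have heq : 1 / (2 * (Real.pi : ℂ)) * ((2 * (t * Real.cos (cauchyAngle k)) /
      ((t * Real.cos (cauchyAngle k)) ^ 2 +
        ((-1) ^ k * t * Real.sin (cauchyAngle k) - x) ^ 2) : ℝ) : ℂ) =
      ((asymCauchyDensity k x t : ℝ) : ℂ) := by
    have h1 : asymCauchyDensity k x t = 1 / (2 * Real.pi) * (2 * (t * Real.cos (cauchyAngle k)) /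
      ((t * Real.cos (cauchyAngle k)) ^ 2 +
        ((-1) ^ k * t * Real.sin (cauchyAngle k) - x) ^ 2)) := by
      have h2 : (x + (-1) ^ (k + 1) * t * Real.sin (cauchyAngle k)) ^ 2
          + t ^ 2 * Real.cos (cauchyAngle k) ^ 2 = (t * Real.cos (cauchyAngle k)) ^ 2 +
          ((-1) ^ k * t * Real.sin (cauchyAngle k) - x) ^ 2 := by
        rw [pow_succ (-1 : ℝ) k]
        ring
      rw [asymCauchyDensity, h2]
      have : 0 < (t * Real.cos (cauchyAngle k)) ^ 2 +
          ((-1) ^ k * t * Real.sin (cauchyAngle k) - x) ^ 2 := by positivity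
      field_simp
    rw [h1]
    push_cast
    rfl
  rw [heq] at hlim
  refine hlim.congr' ?_
  filter_upwards [eventually_ge_atTop 0] with R hR
  rw [integral_truncKernel hμ x hR]
  rfl

theorem continuous_truncKernel (k : ℕ) (R : ℝ) :
    Continuous fun p : ℝ × ℝ => truncKernel k p.1 p.2 R := by
  unfold truncKernel
  refine continuous_const.mul
    (intervalIntegral.continuous_parametric_intervalIntegral_of_continuous' ?_ _ _)
  simp only [Function.uncurry_def]
  fun_prop

theorem index_pos_and_lt_one (hk : 1 ≤ k) :
    0 < 1 / (2 * (k : ℝ) + 1) ∧ 1 / (2 * (k : ℝ) + 1) < 1 := by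
  have : (1 : ℝ) ≤ k := by exact_mod_cast hk
  exact ⟨by positivity, by rw [div_lt_one (by positivity)]; linarith⟩

/-- These are the inputs of dominated convergence: kernel bounds are available only for `s > 0`. The
contour argument excludes `s < 0`, and the small-ball bound excludes an atom at 0. -/
theorem ae_pos_and_integrable_rpow (hk : 1 ≤ k) (ht : 0 < t) (hμ : ∀ β, charFun μ β =
      stableCharFun (1 / (2 * (k : ℝ) + 1)) (1 / (2 * (k : ℝ) + 1)) t β) :
    (∀ᵐ s ∂μ, 0 < s) ∧ Integrable (fun s : ℝ => 10 * |s| ^ (-(1 / (2 * (k : ℝ) + 1)))) μ := by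
  obtain ⟨hα, hα1⟩ := index_pos_and_lt_one hk
  have hcos : 0 < Real.cos (Real.pi * (1 / (2 * (k : ℝ) + 1)) / 2) := by
    refine Real.cos_pos_of_mem_Ioo ⟨?_, ?_⟩ <;> nlinarith [Real.pi_pos]
  have hint : Integrable (charFun μ) :=
    (integrable_exp_neg_mul_abs_rpow (mul_pos ht hcos) hα).mono'
      measurable_charFun.aestronglyMeasurable
      (ae_of_all _ fun β => norm_charFun_le_exp (hμ β) hα)
  have hball : ∀ r : ℝ, 0 < r → μ.real {s | |s| ≤ r} ≤ (∫ β, ‖charFun μ β‖) * r :=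
    fun r hr => measureReal_abs_le_le_of_integrable_charFun μ hint hr
  refine ⟨?_, (integrable_abs_rpow_neg_of_abs_le hball hα hα1).const_mul 10⟩
  have h0 : ∀ᵐ s ∂μ, s ≠ 0 := by
    rw [ae_iff]
    simpa using measure_singleton_zero_of_abs_le hball
  filter_upwards [ae_nonneg_of_charFun_eq_stableCharFun hα hα1.le ht.le hμ, h0] with s hs hs0
  exact lt_of_le_of_ne hs hs0.symm

theorem integral_pseudoDensity_eq (hk : 1 ≤ k) (ht : 0 < t) (hμ : ∀ β, charFun μ β =
      stableCharFun (1 / (2 * (k : ℝ) + 1)) (1 / (2 * (k : ℝ) + 1)) t β) (x : ℝ) :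
    ∫ s, pseudoDensity k x s ∂μ = asymCauchyDensity k x t := by
  obtain ⟨hpos, hi⟩ := ae_pos_and_integrable_rpow hk ht hμ
  have hdct : Tendsto (fun R : ℝ => ∫ s, truncKernel k x s R ∂μ) atTop
      (𝓝 (∫ s, ((pseudoDensity k x s : ℝ) : ℂ) ∂μ)) := by
    refine tendsto_integral_filter_of_dominated_convergence _
      (Eventually.of_forall fun R => ?_) ?_ hi ?_
    · exact ((continuous_truncKernel k R).comp
        (continuous_const.prodMk continuous_id)).aestronglyMeasurable
    · filter_upwards [eventually_ge_atTop 0] with R hR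
      filter_upwards [hpos] with s hs
      rw [abs_of_pos hs]
      exact norm_truncKernel_le hk x hs hR
    · filter_upwards [hpos] with s hs
      exact tendsto_truncKernel hk x hs
  have := tendsto_nhds_unique hdct (tendsto_integral_truncKernel hk ht hμ x)
  rw [integral_complex_ofReal] at this
  exact_mod_cast this

/-- Joint measurability is inherited from the continuous truncated kernels, which converge almost
everywhere. A general finite `ν` serves both a Dirac mass, for a fixed `x`, and Lebesgue measure on
`[a, b]`. -/
theorem integrable_pseudoDensity_prod (hk : 1 ≤ k) (ht : 0 < t) (hμ : ∀ β, charFun μ β =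
      stableCharFun (1 / (2 * (k : ℝ) + 1)) (1 / (2 * (k : ℝ) + 1)) t β) (ν : Measure ℝ)
    [IsFiniteMeasure ν] :
    Integrable (fun p : ℝ × ℝ => pseudoDensity k p.1 p.2) (ν.prod μ) := by
  obtain ⟨hpos, hi⟩ := ae_pos_and_integrable_rpow hk ht hμ
  have hpos' : ∀ᵐ p ∂(ν.prod μ), 0 < p.2 := Measure.quasiMeasurePreserving_snd.ae hpos
  refine (hi.comp_snd ν).mono' ?_ ?_
  · have hm : AEStronglyMeasurable (fun p : ℝ × ℝ => ((pseudoDensity k p.1 p.2 : ℝ) : ℂ))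
        (ν.prod μ) := by
      refine aestronglyMeasurable_of_tendsto_ae atTop
        (fun R => (continuous_truncKernel k R).aestronglyMeasurable) ?_
      filter_upwards [hpos'] with p hp
      exact tendsto_truncKernel hk p.1 hp
    exact hm.re
  · filter_upwards [hpos'] with p hp
    rw [abs_of_pos hp]
    exact abs_pseudoDensity_le hk p.1 hp

theorem integrable_pseudoDensity (hk : 1 ≤ k) (ht : 0 < t) (hμ : ∀ β, charFun μ β =
      stableCharFun (1 / (2 * (k : ℝ) + 1)) (1 / (2 * (k : ℝ) + 1)) t β) (x : ℝ) :
    Integrable (fun s => pseudoDensity k x s) μ := by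
  have h := (integrable_pseudoDensity_prod hk ht hμ (Measure.dirac x)).prod_right_ae
  rwa [ae_dirac_eq, eventually_pure] at h

theorem pseudoLaw_eq_setIntegral (k : ℕ) (s a b : ℝ) :
    pseudoLaw k s a b = ∫ y in Set.Icc a b, pseudoDensity k y s := by
  have hmp := (volume_preserving_funUnique (Fin 1) ℝ).symm (MeasurableEquiv.funUnique (Fin 1) ℝ)
  refine (hmp.setIntegral_preimage_emb (MeasurableEquiv.measurableEmbedding _) _ _).symm.trans ?_
  have : (MeasurableEquiv.funUnique (Fin 1) ℝ).symm ⁻¹' Set.Icc (fun _ => a) (fun _ => b) =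
      Set.Icc a b := (OrderIso.funUnique (Fin 1) ℝ).symm.preimage_Icc _ _
  rw [this]
  simp

theorem integrable_pseudoLaw (hk : 1 ≤ k) (ht : 0 < t) (hμ : ∀ β, charFun μ β =
      stableCharFun (1 / (2 * (k : ℝ) + 1)) (1 / (2 * (k : ℝ) + 1)) t β) (a b : ℝ) :
    Integrable (fun s => pseudoLaw k s a b) μ := by
  simp_rw [pseudoLaw_eq_setIntegral]
  exact (integrable_pseudoDensity_prod hk ht hμ (volume.restrict (Set.Icc a b))).integral_prod_right

theorem integral_pseudoLaw_eq (hk : 1 ≤ k) (ht : 0 < t) (hμ : ∀ β, charFun μ β =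
      stableCharFun (1 / (2 * (k : ℝ) + 1)) (1 / (2 * (k : ℝ) + 1)) t β) {a b : ℝ} (hab : a ≤ b) :
    ∫ s, pseudoLaw k s a b ∂μ = ∫ x in a..b, asymCauchyDensity k x t := by
  simp_rw [pseudoLaw_eq_setIntegral]
  rw [← integral_integral_swap
    (integrable_pseudoDensity_prod hk ht hμ (volume.restrict (Set.Icc a b)))]
  simp_rw [integral_pseudoDensity_eq hk ht hμ]
  rw [intervalIntegral.integral_of_le hab, integral_Icc_eq_integral_Ioc]

end StableLaw

theorem mainTheorem2 (k : ℕ) (hk : 1 ≤ k) {Ω : Type*} [MeasurableSpace Ω] (P : Measure Ω)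
    [IsProbabilityMeasure P] (S : ℝ → Ω → ℝ)
    (hS : HasStableLaws P (1 / (2 * (k : ℝ) + 1)) (1 / (2 * (k : ℝ) + 1)) S) :
    -- the improper integral that defines the density of the pseudo-process converges
    (∀ x s : ℝ, 0 < s →
      Tendsto (truncKernel k x s) atTop (𝓝 ((pseudoDensity k x s : ℝ) : ℂ))) ∧
    -- the composition has the stated density
    (∀ x t : ℝ, 0 < t →
      IntegrableOn (fun s => pseudoDensity k x s) (Set.Ioi 0) (P.map (S t)) ∧
      composedDensity P k S x t = asymCauchyDensity k x t) ∧
    -- the law of the composition is the Cauchy law with the stated location and scale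
    (∀ t a b : ℝ, 0 < t → a ≤ b →
      IntegrableOn (fun s => pseudoLaw k s a b) (Set.Ioi 0) (P.map (S t)) ∧
      composedLaw P k S t a b = ∫ x in a..b, asymCauchyDensity k x t ∧
      composedLaw P k S t a b =
        (cauchyMeasure ((-1) ^ k * t * Real.sin (cauchyAngle k))
          (Real.toNNReal (t * Real.cos (cauchyAngle k)))).real (Set.Icc a b)) ∧
    -- the density is smooth for `t > 0` and solves the higher-order Laplace equation
    ContDiffOn ℝ ∞ (fun p : ℝ × ℝ => asymCauchyDensity k p.1 p.2) (Set.univ ×ˢ Set.Ioi 0) ∧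
    (∀ x t : ℝ, 0 < t →
      iteratedDeriv (2 * k + 1) (fun τ => asymCauchyDensity k x τ) t +
        iteratedDeriv (2 * k + 1) (fun y => asymCauchyDensity k y t) x = 0) := by
  have hprob : ∀ t, 0 < t → IsProbabilityMeasure (P.map (S t)) := fun t ht =>
    Measure.isProbabilityMeasure_map (hS.aemeasurable t ht)
  -- Since `S(t) > 0` almost surely, integrals over `(0, ∞)` are integrals over the whole line.
  have hrestrict : ∀ t, 0 < t → (P.map (S t)).restrict (Set.Ioi 0) = P.map (S t) := fun t ht =>
    haveI := hprob t ht
    Measure.restrict_eq_self_of_ae_mem (ae_pos_and_integrable_rpow hk ht (hS.charFun_eq t ht)).1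
  refine ⟨fun x s hs => tendsto_truncKernel hk x hs, fun x t ht => ?_, fun t a b ht hab => ?_,
    contDiffOn_asymCauchyDensity hk, fun x t ht => asymCauchyDensity_higherOrderLaplace hk x ht⟩
  · have := hprob t ht
    rw [IntegrableOn, composedDensity, hrestrict t ht]
    exact ⟨integrable_pseudoDensity hk ht (hS.charFun_eq t ht) x,
      integral_pseudoDensity_eq hk ht (hS.charFun_eq t ht) x⟩
  · have := hprob t ht
    have hlaw := integral_pseudoLaw_eq hk ht (hS.charFun_eq t ht) hab
    rw [IntegrableOn, composedLaw, hrestrict t ht]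
    exact ⟨integrable_pseudoLaw hk ht (hS.charFun_eq t ht) a b, hlaw,
      hlaw.trans (cauchyMeasure_real_Icc hk ht hab).symm⟩
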